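/- **Theorem (local Minty theorem).** Let $X$ be a reflexive real Banach space with dual $X^*$. For $S:X\rightrightarrows X^*$ write $\operatorname{gph}S=\{(x,x^*)\mid x^*\in S(x)\}$. The operator $S$ is *monotone* if $\langle x_1^*-x_2^*,x_1-x_2\rangle\ge 0$ for all $(x_1,x_1^*),(x_2,x_2^*)\in\operatorname{gph}S$; a monotone $S$ is *maximal monotone* if $\operatorname{gph}S=\operatorname{gph}S'$ for every monotone $S'$ with $\operatorname{gph}S\subset\operatorname{gph}S'$. The operator $S$ is *monotone with respect to* $W\subset X\times X^*$ if $\operatorname{gph}\bar S\cap W=\operatorname{gph}S\cap W$ for some monotone $\bar S:X\rightrightarrows X^*$. Let $T:X\rightrightarrows X^*$ and $(\bar x,\bar x^*)\in\operatorname{gph}T$. Then $T$ is, around $(\bar x,\bar x^*)$, * *locally monotone* if there is an open neighborhood $U\times V$ of $(\bar x,\bar x^*)$ such that $T$ is monotone with respect to $U\times V$; * *locally maximal monotone of type (A)* if there is an open neighborhood $U\times V$ of $(\bar x,\bar x^*)$ such that $T$ is monotone with respect to $U\times V$ and $\operatorname{gph}T\cap(U\times V)=\operatorname{gph}S\cap(U\times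 V)$ for every $S:X\rightrightarrows X^*$ that is monotone with respect to $U\times V$ and satisfies $\operatorname{gph}T\cap(U\times V)\subset\operatorname{gph}S\cap(U\times V)$; * *locally maximal monotone of type (B)* if there are an open neighborhood $U\times V$ of $(\bar x,\bar x^*)$ and a maximal monotone $\bar T:X\rightrightarrows X^*$ with $\operatorname{gph}\bar T\cap(U\times V)=\operatorname{gph}T\cap(U\times V)$. A set-valued mapping $F:Y\rightrightarrows Z$ has a *continuous single-valued localization* around $(\bar y,\bar z)\in\operatorname{gph}F$ if there is an open neighborhood $U\times V$ of $(\bar y,\bar z)$ such that the mapping $\widehat F$ with $\operatorname{gph}\widehat F=\operatorname{gph}F\cap(U\times V)$ has domain $U$ and is single-valued and continuous on $U$. 1. Suppose that the norm of $X$ is Fréchet differentiable on $X\setminus\{0\}$, strictly convex, and Kadec–Klee (if $x_k\to x$ weakly and $\|x_k\|\to\|x\|$, then $\|x_k-x\|\to0$). Let $J(x)=\{x^*\in X^*\mid\langle x^*,x\rangle=\|x\|^2=\|x^*\|^2\}$ be the duality mapping, which is then single-valued. The following assertions are equivalent: * (i) $T$ is locally maximal monotone of type (B) around $(\bar x,\bar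 x^*)$; * (ii) $T$ is locally monotone around $(\bar x,\bar x^*)$ and, for every $\lambda>0$, the resolvent $(J+\lambda T)^{-1}:X^*\rightrightarrows X$ has a continuous single-valued localization around $(J(\bar x)+\lambda\bar x^*,\bar x)$; * (iii) $T$ is locally maximal monotone of type (A) around $(\bar x,\bar x^*)$. 2. In particular, without any assumption on the norm of the reflexive space $X$, $T$ is locally maximal monotone of type (A) around $(\bar x,\bar x^*)$ if and only if it is locally maximal monotone of type (B) around $(\bar x,\bar x^*)$. -/

import Mathlib

open Set Filter Topology

section Multifunctions

variable {Y Z : Type*}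

/-- The graph of a set-valued mapping `F : Y ⇉ Z`. -/
def mfGraph (F : Y → Set Z) : Set (Y × Z) := {p | p.2 ∈ F p.1}

/-- `F : Y ⇉ Z` has a continuous single-valued localization around `(y, z)`: for some open
neighborhood `U ×ˢ V` of `(y, z)`, the mapping `G` with `gph G = gph F ∩ (U × V)` is single-valued
on `U` with `dom G = U`, and is continuous on `U`. -/
def HasContSingleValuedLocalization [TopologicalSpace Y] [TopologicalSpace Z]
    (F : Y → Set Z) (y : Y) (z : Z) : Prop :=
  ∃ (U : Set Y) (V : Set Z), IsOpen U ∧ IsOpen V ∧ y ∈ U ∧ z ∈ V ∧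
    ∃ G : Y → Set Z, mfGraph G = mfGraph F ∩ U ×ˢ V ∧
      ∃ g : Y → Z, ContinuousOn g U ∧ ∀ u ∈ U, G u = {g u}

end Multifunctions

section Operators

variable {X : Type*} [NormedAddCommGroup X] [NormedSpace ℝ X]

/-- Global monotonicity of `T : X ⇉ X*`. -/
def IsMonotoneOp (T : X → Set (StrongDual ℝ X)) : Prop :=
  ∀ p ∈ mfGraph T, ∀ q ∈ mfGraph T, 0 ≤ (p.2 - q.2) (p.1 - q.1)

/-- Global maximal monotonicity of `T : X ⇉ X*`. -/
def IsMaxMonotoneOp (T : X → Set (StrongDual ℝ X)) : Prop :=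
  IsMonotoneOp T ∧
    ∀ S : X → Set (StrongDual ℝ X), IsMonotoneOp S → mfGraph T ⊆ mfGraph S →
      mfGraph T = mfGraph S

/-- `T` is monotone with respect to `W`: it coincides on `W` with a globally monotone operator. -/
def IsMonotoneOpWrt (T : X → Set (StrongDual ℝ X)) (W : Set (X × StrongDual ℝ X)) : Prop :=
  ∃ Tbar : X → Set (StrongDual ℝ X), IsMonotoneOp Tbar ∧ mfGraph Tbar ∩ W = mfGraph T ∩ W

/-- `T` is locally monotone around `(x, xs)`. -/
def IsLocallyMonotone (T : X → Set (StrongDual ℝ X)) (x : X) (xs : StrongDual ℝ X) : Prop :=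
  ∃ (U : Set X) (V : Set (StrongDual ℝ X)), IsOpen U ∧ IsOpen V ∧ x ∈ U ∧ xs ∈ V ∧
    IsMonotoneOpWrt T (U ×ˢ V)

/-- `T` is locally maximal monotone of type (A) around `(x, xs)`: on some neighborhood `U ×ˢ V` it
is monotone and its graph cannot be properly enlarged inside `U ×ˢ V` while keeping monotonicity
with respect to `U ×ˢ V`. -/
def IsLocallyMaxMonotoneA (T : X → Set (StrongDual ℝ X)) (x : X) (xs : StrongDual ℝ X) : Prop :=
  ∃ (U : Set X) (V : Set (StrongDual ℝ X)), IsOpen U ∧ IsOpen V ∧ x ∈ U ∧ xs ∈ V ∧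
    IsMonotoneOpWrt T (U ×ˢ V) ∧
    ∀ S : X → Set (StrongDual ℝ X), IsMonotoneOpWrt S (U ×ˢ V) →
      mfGraph T ∩ U ×ˢ V ⊆ mfGraph S ∩ U ×ˢ V → mfGraph T ∩ U ×ˢ V = mfGraph S ∩ U ×ˢ V

/-- `T` is locally maximal monotone of type (B) around `(x, xs)`: on some neighborhood `U ×ˢ V` it
coincides with a globally maximal monotone operator. -/
def IsLocallyMaxMonotoneB (T : X → Set (StrongDual ℝ X)) (x : X) (xs : StrongDual ℝ X) : Prop :=
  ∃ (U : Set X) (V : Set (StrongDual ℝ X)), IsOpen U ∧ IsOpen V ∧ x ∈ U ∧ xs ∈ V ∧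
    ∃ Tbar : X → Set (StrongDual ℝ X), IsMaxMonotoneOp Tbar ∧
      mfGraph Tbar ∩ U ×ˢ V = mfGraph T ∩ U ×ˢ V

/-- The (set-valued) duality mapping `J(x) = {x* | ⟨x*, x⟩ = ‖x‖² = ‖x*‖²}`. -/
def dualityMapping (x : X) : Set (StrongDual ℝ X) :=
  {xs | xs x = ‖x‖ ^ 2 ∧ ‖x‖ ^ 2 = ‖xs‖ ^ 2}

/-- The resolvent `(J + lam T)⁻¹ : X* ⇉ X`. -/
def dualityResolvent (T : X → Set (StrongDual ℝ X)) (lam : ℝ) (ys : StrongDual ℝ X) : Set X :=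
  {x | ∃ j ∈ dualityMapping x, ∃ xs ∈ T x, ys = j + lam • xs}

variable (X)

/-- Reflexivity: the canonical embedding into the bidual is onto. -/
def IsReflexiveSpace : Prop :=
  Function.Surjective (NormedSpace.inclusionInDoubleDual ℝ X)

/-- The norm is Fréchet differentiable at every nonzero point. -/
def IsFrechetSmoothNorm : Prop :=
  ∀ x : X, x ≠ 0 → DifferentiableAt ℝ (fun y : X => ‖y‖) x

/-- The Kadec–Klee property: a weakly convergent sequence whose norms converge to the norm of the
weak limit converges in norm. -/
def IsKadecKleeNorm : Prop :=
  ∀ (u : ℕ → X) (x : X),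
    (∀ f : StrongDual ℝ X, Tendsto (fun n => f (u n)) atTop (𝓝 (f x))) →
    Tendsto (fun n => ‖u n‖) atTop (𝓝 ‖x‖) → Tendsto u atTop (𝓝 x)

variable {X}

/-- The duality mapping has nonempty values. -/
theorem dualityMapping_nonempty (x : X) : (dualityMapping x).Nonempty := by
  obtain ⟨f, hf, hx⟩ := exists_dual_vector'' ℝ x
  rcases eq_or_ne x 0 with rfl | h
  · exact ⟨0, by simp [dualityMapping]⟩
  · have hpos : 0 < ‖x‖ := norm_pos_iff.mpr h
    have hx' : f x = ‖x‖ := by simpa using hx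
    have h1 : ‖f‖ = 1 := by
      refine le_antisymm hf ?_
      have h2 := f.le_opNorm x
      rw [hx', norm_norm] at h2
      nlinarith
    refine ⟨‖x‖ • f, ?_, ?_⟩
    · simp [hx', sq]
    · simp [norm_smul, h1]

end Operators

/-!
The implication from type (A) to type (B) is Zorn's lemma: a maximal monotone extension of the
restricted graph of `T` agrees with `T` on the neighborhood, by maximality in the sense of (A).

The converse depends on the choice of the neighborhood: the points of the graph that test a given
`(y, y*)` must not leave it, and a product of balls gives no control of that. Let `S` be maximal
monotone with `(x, x*)` in its graph. Take `U = ball x r` and let `V` consist of the values of `S`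
over `U` that lie in `ball x* R`, each fattened by a radius that tends to zero at the
boundary (`fattenedRange`). Given `(y, y*) ∈ U × V` monotonically related to the graph of `S` inside
`U × V`, perturb `S` by the subdifferential of a small quadratic centered at `y` plus a penalty for
leaving `U`; the perturbed operator takes the value `y*` at some `b ∈ U`. As `y*` is close to the
range of `S` over `U`, the perturbation at `b` is small, so the value of `S` at `b` is again in `V`
and can be tested against `(y, y*)`. This forces `b = y`, hence `y* ∈ S y`
(`IsMaxMonotoneOp.mem_of_forall_nonneg_of_mem_ball`). No smoothness of the norm enters.

The solvability of the perturbed inclusion, and the surjectivity of `J + lam T`, are both instances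
of `IsMaxMonotoneOp.exists_neg_mem_subgradient`, a Hahn–Banach separation argument based on the
Fitzpatrick function.

For a Fréchet smooth, strictly convex, Kadec–Klee norm, `J` is continuous and strictly monotone, and
the resolvent of a maximal monotone operator is single-valued and continuous; this passes to `T`
locally. Conversely, a localized resolvent of `T` supplies enough points of the graph of `T` for
every maximal monotone extension to agree with `T` near `(x, x*)`.
-/

/-! ### Convex functions and a surjectivity theorem of Minty–Rockafellar type -/

section Convex

variable {X : Type*} [NormedAddCommGroup X] [NormedSpace ℝ X]

/-- A continuous convex function has a subgradient at every point. -/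
theorem ConvexOn.exists_subgradient {φ : X → ℝ} (hφ : ConvexOn ℝ univ φ) (hc : Continuous φ)
    (b : X) : ∃ p : StrongDual ℝ X, ∀ z, φ b + p (z - b) ≤ φ z := by
  have hconv : Convex ℝ {p : X × ℝ | p.1 ∈ univ ∧ φ p.1 < p.2} := hφ.convex_strict_epigraph
  have hopen : IsOpen {p : X × ℝ | p.1 ∈ univ ∧ φ p.1 < p.2} := by
    simpa using isOpen_lt (hc.comp continuous_fst) continuous_snd
  obtain ⟨f, hf⟩ := geometric_hahn_banach_point_open (x := (b, φ b)) hconv hopen (by simp)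
  set c := f (0, 1)
  have hsplit : ∀ z t, f (z, t) = f (z, 0) + c * t := by
    intro z t
    have : (z, t) = (z, (0 : ℝ)) + t • ((0 : X), (1 : ℝ)) := by simp
    rw [this, map_add, map_smul, smul_eq_mul, mul_comm]
  have hcpos : 0 < c := by
    have := hf (b, φ b + 1) (by simp)
    rw [hsplit b, hsplit b (φ b + 1)] at this
    linarith
  refine ⟨-(c⁻¹ • f.comp (ContinuousLinearMap.inl ℝ X ℝ)), fun z => ?_⟩
  have key : f (b, 0) + c * φ b ≤ f (z, 0) + c * φ z := by
    refine le_of_forall_pos_lt_add fun ε hε => ?_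
    have := hf (z, φ z + ε / c) (by simpa using div_pos hε hcpos)
    rw [hsplit b, hsplit z] at this
    have h2 : c * (φ z + ε / c) = c * φ z + ε := by field_simp
    linarith
  have hsub : f (z - b, 0) = f (z, 0) - f (b, 0) := by
    rw [← map_sub]; simp
  have h3 : (-(c⁻¹ • f.comp (ContinuousLinearMap.inl ℝ X ℝ))) (z - b)
      = -(c⁻¹ * (f (z, 0) - f (b, 0))) := by
    simp [← hsub]
  rw [h3]
  have h4 : φ b - φ z ≤ c⁻¹ * (f (z, 0) - f (b, 0)) := by
    rw [inv_mul_eq_div, le_div_iff₀ hcpos]; linarith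
  linarith

/-- A function on a normed space is supercoercive if it grows faster than every multiple of the
norm. -/
def IsSupercoercive (φ : X → ℝ) : Prop := ∀ M : ℝ, ∃ C : ℝ, ∀ z, M * ‖z‖ - φ z ≤ C

/-- The Fenchel conjugate of `φ`. The supremum is taken in `ℝ`, so it is meaningful only where
`p - φ` is bounded above; for supercoercive `φ` that is everywhere. -/
noncomputable def fenchelConj (φ : X → ℝ) (p : StrongDual ℝ X) : ℝ := ⨆ z, (p z - φ z)

namespace IsSupercoercive

variable {φ : X → ℝ}

theorem exists_conj_bound (h : IsSupercoercive φ) (M : ℝ) :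
    ∃ C, ∀ p : StrongDual ℝ X, ‖p‖ ≤ M → ∀ z, p z - φ z ≤ C := by
  obtain ⟨C, hC⟩ := h M
  refine ⟨C, fun p hp z => le_trans ?_ (hC z)⟩
  have h1 := (le_abs_self _).trans (p.le_opNorm z)
  have h2 := mul_le_mul_of_nonneg_right hp (norm_nonneg z)
  linarith

theorem le_fenchelConj (h : IsSupercoercive φ) (p : StrongDual ℝ X) (z : X) :
    p z - φ z ≤ fenchelConj φ p := by
  obtain ⟨C, hC⟩ := h.exists_conj_bound ‖p‖
  exact le_ciSup (f := fun z => p z - φ z) ⟨C, by rintro _ ⟨z, rfl⟩; exact hC p le_rfl z⟩ z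

theorem convexOn_fenchelConj (h : IsSupercoercive φ) :
    ConvexOn ℝ univ (fenchelConj φ) := by
  refine ⟨convex_univ, fun p _ q _ a b ha hb hab => ciSup_le fun z => ?_⟩
  have h1 := mul_le_mul_of_nonneg_left (h.le_fenchelConj p z) ha
  have h2 := mul_le_mul_of_nonneg_left (h.le_fenchelConj q z) hb
  have h3 : (a • p + b • q) z - φ z = a * (p z - φ z) + b * (q z - φ z) := by
    simp only [add_apply, smul_apply, smul_eq_mul]
    linear_combination (φ z) * hab
  simp only [smul_eq_mul]
  linarith

/-- A convex function on a normed space is continuous as soon as it is bounded above near one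
point; the supercoercivity of `φ` bounds its conjugate on balls. -/
theorem continuous_fenchelConj (h : IsSupercoercive φ) : Continuous (fenchelConj φ) := by
  rw [← continuousOn_univ]
  have := (ConvexOn.continuousOn_tfae isOpen_univ univ_nonempty h.convexOn_fenchelConj).out 1 3
  rw [this]
  obtain ⟨C, hC⟩ := h.exists_conj_bound 1
  refine ⟨0, mem_univ _, C, ?_⟩
  rw [eventually_map]
  filter_upwards [Metric.ball_mem_nhds (0 : StrongDual ℝ X) one_pos] with p hp
  exact ciSup_le (hC p (by simpa using (mem_ball_zero_iff.mp hp).le))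

end IsSupercoercive

theorem IsMonotoneOp.nonneg {T : X → Set (StrongDual ℝ X)} (hT : IsMonotoneOp T) {x y : X}
    {xs ys : StrongDual ℝ X} (hx : xs ∈ T x) (hy : ys ∈ T y) : 0 ≤ (xs - ys) (x - y) :=
  hT (x, xs) hx (y, ys) hy

theorem IsMaxMonotoneOp.mem_of_forall_nonneg {T : X → Set (StrongDual ℝ X)}
    (hT : IsMaxMonotoneOp T) {y : X} {ys : StrongDual ℝ X}
    (h : ∀ a, ∀ as ∈ T a, 0 ≤ (ys - as) (y - a)) : ys ∈ T y := by
  let S : X → Set (StrongDual ℝ X) := fun z => {zs | zs ∈ T z ∨ (z = y ∧ zs = ys)}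
  have hS : IsMonotoneOp S := by
    rintro ⟨a, as⟩ (ha | ⟨rfl, rfl⟩) ⟨c, cs⟩ (hc | ⟨rfl, rfl⟩)
    · exact hT.1.nonneg ha hc
    · have := h a as ha
      rw [← neg_sub as, ← neg_sub a, map_neg, neg_apply, neg_neg] at this
      exact this
    · exact h c cs hc
    · simp
  have hTS := hT.2 S hS fun p hp => Or.inl hp
  have : (y, ys) ∈ mfGraph S := Or.inr ⟨rfl, rfl⟩
  rwa [← hTS] at this

/-- Let `X` be reflexive, `T` maximal monotone, and `φ` continuous, convex and supercoercive. Then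
`0 ∈ ∂φ(b) + T b` for some `b`.

The set of `(x, x*, t)` with `t` at least the Fitzpatrick function of `T` at `(x, x*)` lies above
the graph of the duality product, while that of `-φ(x) - φ*(-x*)` lies below it. A hyperplane
separating the two sets, read through reflexivity, yields the point of the graph of `T`. -/
theorem IsMaxMonotoneOp.exists_neg_mem_subgradient (hX : IsReflexiveSpace X)
    {T : X → Set (StrongDual ℝ X)} (hT : IsMaxMonotoneOp T) (hne : (mfGraph T).Nonempty)
    {φ : X → ℝ} (hφ : ConvexOn ℝ univ φ) (hc : Continuous φ) (hs : IsSupercoercive φ) :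
    ∃ (b : X) (bs : StrongDual ℝ X), bs ∈ T b ∧ ∀ z, φ b - bs (z - b) ≤ φ z := by
  obtain ⟨⟨a₀, as₀⟩, ha₀⟩ := hne
  let A : Set (X × StrongDual ℝ X × ℝ) :=
    {w | ∀ a, ∀ as ∈ T a, as w.1 + w.2.1 a - as a ≤ w.2.2}
  let B : Set (X × StrongDual ℝ X × ℝ) :=
    {w | w.2.2 + φ w.1 + fenchelConj φ (-w.2.1) < 0}
  have hAgraph : ∀ a, ∀ as ∈ T a, ∀ t, as a ≤ t → (a, as, t) ∈ A := by
    intro a as ha t ht c cs hcs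
    have := hT.1.nonneg ha hcs
    simp only [map_sub, sub_apply] at this
    dsimp only
    linarith
  have hAge : ∀ w ∈ A, w.2.1 w.1 ≤ w.2.2 := by
    rintro ⟨y, ys, t⟩ hw
    by_contra! hlt
    dsimp only at hlt
    have hmem : ys ∈ T y := hT.mem_of_forall_nonneg fun a as ha => by
      have := hw a as ha
      simp only [map_sub, sub_apply]
      dsimp only at this
      linarith
    have := hw y ys hmem
    dsimp only at this
    linarith
  have hAconv : Convex ℝ A := by
    intro v hv w hw α β hα hβ hαβ a as ha
    have h1 := mul_le_mul_of_nonneg_left (hv a as ha) hα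
    have h2 := mul_le_mul_of_nonneg_left (hw a as ha) hβ
    simp only [Prod.fst_add, Prod.snd_add, Prod.smul_fst, Prod.smul_snd, map_add, map_smul,
      add_apply, smul_apply, smul_eq_mul]
    linear_combination h1 + h2 + (as a) * hαβ
  have hBconv : Convex ℝ B := by
    intro v hv w hw α β hα hβ hαβ
    have h1 := hφ.2 (mem_univ v.1) (mem_univ w.1) hα hβ hαβ
    have h2 := hs.convexOn_fenchelConj.2 (mem_univ (-v.2.1)) (mem_univ (-w.2.1)) hα hβ hαβ
    have h3 : α • (-v.2.1) + β • (-w.2.1) = -(α • v.2.1 + β • w.2.1) := by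
      simp only [smul_neg]; abel
    rw [h3] at h2
    simp only [B, mem_ofPred_eq, Prod.fst_add, Prod.snd_add, Prod.smul_fst, Prod.smul_snd,
      smul_eq_mul] at hv hw h1 h2 ⊢
    have h4 : α * (v.2.2 + φ v.1 + fenchelConj φ (-v.2.1))
        + β * (w.2.2 + φ w.1 + fenchelConj φ (-w.2.1)) < 0 := by
      rcases hα.eq_or_lt with rfl | hα'
      · have : β = 1 := by linarith
        subst this
        linarith
      · have := mul_neg_of_pos_of_neg hα' hv
        have := mul_nonpos_of_nonneg_of_nonpos hβ hw.le
        linarith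
    linarith
  have hBopen : IsOpen B := by
    have := hs.continuous_fenchelConj
    exact isOpen_lt (by fun_prop) continuous_const
  have hdisj : Disjoint B A := by
    rw [Set.disjoint_left]
    rintro ⟨x, xs, t⟩ hB hA
    have h1 := hAge _ hA
    have h2 := hs.le_fenchelConj (-xs) x
    simp only [B, mem_ofPred_eq, neg_apply] at h1 h2 hB
    linarith
  obtain ⟨f, u, hfB, hfA⟩ := geometric_hahn_banach_open hBconv hBopen hAconv hdisj
  set c := f (0, 0, 1)
  have hsplit : ∀ x xs t, f (x, xs, t) = f (x, 0, 0) + f (0, xs, 0) + c * t := by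
    intro x xs t
    have : (x, xs, t) = (x, (0 : StrongDual ℝ X), (0 : ℝ)) + ((0 : X), xs, (0 : ℝ))
        + t • ((0 : X), (0 : StrongDual ℝ X), (1 : ℝ)) := by simp
    rw [this, map_add, map_add, map_smul, smul_eq_mul, mul_comm]
  -- The hyperplane is not vertical, since `B` contains points below the point `a₀` of the graph.
  have hcpos : 0 < c := by
    set t₁ := -φ a₀ - fenchelConj φ (-as₀) - 1 with ht₁
    have h1 := hfB (a₀, as₀, t₁) (by simp only [B, mem_ofPred_eq, ht₁]; linarith)
    have h2 := hfA (a₀, as₀, as₀ a₀) (hAgraph a₀ as₀ ha₀ _ le_rfl)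
    rw [hsplit] at h1 h2
    have h3 := hs.le_fenchelConj (-as₀) a₀
    rw [neg_apply] at h3
    have h4 : t₁ < as₀ a₀ := by linarith
    nlinarith
  obtain ⟨p, hp⟩ : ∃ p : StrongDual ℝ X, ∀ x, f (x, 0, 0) = -(c * p x) := by
    refine ⟨-(c⁻¹ • f.comp (ContinuousLinearMap.inl ℝ X (StrongDual ℝ X × ℝ))), fun x => ?_⟩
    have : (c⁻¹ • f.comp (ContinuousLinearMap.inl ℝ X (StrongDual ℝ X × ℝ))) x
        = c⁻¹ * f (x, 0, 0) := rfl
    rw [neg_apply, this]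
    field_simp
  obtain ⟨b, hb⟩ := hX (-(c⁻¹ • f.comp ((ContinuousLinearMap.inr ℝ X (StrongDual ℝ X × ℝ)).comp
    (ContinuousLinearMap.inl ℝ (StrongDual ℝ X) ℝ))))
  have hb' : ∀ xs : StrongDual ℝ X, f (0, xs, 0) = -(c * xs b) := by
    intro xs
    have : xs b = -(c⁻¹ * f (0, xs, 0)) := by
      rw [← NormedSpace.dual_def ℝ X b xs, hb]
      simp
    rw [this]; field_simp
  set κ := u / c with hκ
  have hu : u = c * κ := by rw [hκ]; field_simp
  have hA' : ∀ a, ∀ as ∈ T a, κ ≤ as a - p a - as b := by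
    intro a as ha
    have := hfA (a, as, as a) (hAgraph a as ha _ le_rfl)
    rw [hsplit, hp, hb', hu] at this
    have h : c * κ ≤ c * (as a - p a - as b) := by linarith
    exact le_of_mul_le_mul_left h hcpos
  have hB' : ∀ x xs, 0 ≤ φ x + fenchelConj φ (-xs) + p x + xs b + κ := by
    intro x xs
    refine le_of_forall_pos_lt_add fun ε hε => ?_
    have := hfB (x, xs, -φ x - fenchelConj φ (-xs) - ε)
      (by simp only [B, mem_ofPred_eq]; linarith)
    rw [hsplit, hp, hb', hu] at this
    have h : c * (-φ x - fenchelConj φ (-xs) - ε - p x - xs b) < c * κ := by linarith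
    have := lt_of_mul_lt_mul_left h hcpos.le
    linarith
  -- A subgradient at `b` turns the bound for the conjugate into one for `φ` itself.
  have hφκ : ∀ x, φ b - p x - κ ≤ φ x := by
    intro x
    obtain ⟨g, hg⟩ := hφ.exists_subgradient hc b
    have h1 := hB' x (-g)
    have h2 : fenchelConj φ (- -g) ≤ g b - φ b := ciSup_le fun z => by
      have := hg z
      rw [map_sub] at this
      rw [neg_neg]
      linarith
    rw [neg_apply] at h1
    linarith
  have hκge : -p b ≤ κ := by linarith [hφκ b]
  have hmem : p ∈ T b := hT.mem_of_forall_nonneg fun a as ha => by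
    have := hA' a as ha
    simp only [map_sub, sub_apply]
    linarith
  have hκle := hA' b p hmem
  refine ⟨b, p, hmem, fun z => ?_⟩
  have := hφκ z
  rw [map_sub]
  linarith

end Convex

/-! ### Maximal extensions and monotonicity relative to a set -/

section Extension

variable {X : Type*} [NormedAddCommGroup X] [NormedSpace ℝ X]

theorem isMonotoneOpWrt_iff {T : X → Set (StrongDual ℝ X)} {W : Set (X × StrongDual ℝ X)} :
    IsMonotoneOpWrt T W ↔
      ∀ p ∈ mfGraph T ∩ W, ∀ q ∈ mfGraph T ∩ W, 0 ≤ (p.2 - q.2) (p.1 - q.1) := by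
  constructor
  · rintro ⟨S, hS, hST⟩ p hp q hq
    rw [← hST] at hp hq
    exact hS p hp.1 q hq.1
  · intro h
    refine ⟨fun x => {xs | (x, xs) ∈ mfGraph T ∩ W}, fun p hp q hq => h p hp q hq, ?_⟩
    ext p
    exact ⟨fun hp => hp.1, fun hp => ⟨hp, hp.2⟩⟩

theorem IsMonotoneOpWrt.exists_isMaxMonotoneOp {T : X → Set (StrongDual ℝ X)}
    {W : Set (X × StrongDual ℝ X)} (h : IsMonotoneOpWrt T W) :
    ∃ S : X → Set (StrongDual ℝ X), IsMaxMonotoneOp S ∧ mfGraph T ∩ W ⊆ mfGraph S := by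
  obtain ⟨G, hTG, hG⟩ := zorn_subset_nonempty
    {G : Set (X × StrongDual ℝ X) | ∀ p ∈ G, ∀ q ∈ G, 0 ≤ (p.2 - q.2) (p.1 - q.1)}
    (fun c hc hchain _ => by
      refine ⟨⋃₀ c, ?_, fun s hs => subset_sUnion_of_mem hs⟩
      rintro p ⟨s, hs, hp⟩ q ⟨t, ht, hq⟩
      rcases hchain.total hs ht with hst | hts
      · exact hc ht p (hst hp) q hq
      · exact hc hs p hp q (hts hq))
    (mfGraph T ∩ W) (isMonotoneOpWrt_iff.mp h)
  exact ⟨fun x => {xs | (x, xs) ∈ G}, ⟨hG.prop, fun S hS hGS => hG.eq_of_subset hS hGS⟩, hTG⟩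

theorem isLocallyMaxMonotoneB_iff_eventually {T : X → Set (StrongDual ℝ X)} {x : X}
    {xs : StrongDual ℝ X} : IsLocallyMaxMonotoneB T x xs ↔
      ∃ S : X → Set (StrongDual ℝ X), IsMaxMonotoneOp S ∧
        ∀ᶠ p in 𝓝 (x, xs), p ∈ mfGraph S ↔ p ∈ mfGraph T := by
  constructor
  · rintro ⟨U, V, hU, hV, hx, hxs, S, hS, hST⟩
    refine ⟨S, hS, ?_⟩
    filter_upwards [(hU.prod hV).mem_nhds ⟨hx, hxs⟩] with p hp
    have := Set.ext_iff.mp hST p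
    simpa [mem_inter_iff, hp] using this
  · rintro ⟨S, hS, hST⟩
    obtain ⟨U, V, hU, hx, hV, hxs, hsub⟩ := mem_nhds_prod_iff'.mp hST
    refine ⟨U, V, hU, hV, hx, hxs, S, hS, ?_⟩
    ext p
    exact and_congr_left fun hp => hsub hp

theorem IsLocallyMaxMonotoneA.isLocallyMaxMonotoneB {T : X → Set (StrongDual ℝ X)} {x : X}
    {xs : StrongDual ℝ X} (h : IsLocallyMaxMonotoneA T x xs) : IsLocallyMaxMonotoneB T x xs := by
  obtain ⟨U, V, hU, hV, hx, hxs, hT, hmax⟩ := h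
  obtain ⟨S, hS, hTS⟩ := hT.exists_isMaxMonotoneOp
  exact ⟨U, V, hU, hV, hx, hxs, S, hS,
    (hmax S ⟨S, hS.1, rfl⟩ fun p hp => ⟨hTS hp, hp.2⟩).symm⟩

end Extension

/-! ### Restricting a maximal monotone operator to a small product neighborhood -/

section Localization

variable {X : Type*} [NormedAddCommGroup X] [NormedSpace ℝ X]

/-- The values of `T` at points of `ball x r` that lie in `ball xs R`, each fattened to a ball.
The radius of the ball added at `(a, a*)` shrinks to zero as `a` or `a*` approaches the boundary. -/
def fattenedRange (T : X → Set (StrongDual ℝ X)) (x : X) (xs : StrongDual ℝ X) (r R : ℝ) :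
    Set (StrongDual ℝ X) :=
  {ys | ∃ a, ∃ as ∈ T a, ‖a - x‖ < r ∧ ‖as - xs‖ < R ∧
    ‖ys - as‖ < (r - ‖a - x‖) * (R - ‖as - xs‖) / (10 * r)}

theorem isOpen_fattenedRange (T : X → Set (StrongDual ℝ X)) (x : X) (xs : StrongDual ℝ X)
    (r R : ℝ) : IsOpen (fattenedRange T x xs r R) := by
  have : fattenedRange T x xs r R = ⋃ a, ⋃ as ∈ {as | as ∈ T a ∧ ‖a - x‖ < r ∧ ‖as - xs‖ < R},
      Metric.ball as ((r - ‖a - x‖) * (R - ‖as - xs‖) / (10 * r)) := by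
    ext ys
    simp only [fattenedRange, mem_ofPred_eq, mem_iUnion, mem_ball_iff_norm, exists_prop, and_assoc]
  rw [this]
  exact isOpen_iUnion fun a => isOpen_biUnion fun as _ => Metric.isOpen_ball

theorem mem_fattenedRange {T : X → Set (StrongDual ℝ X)} {x a : X} {xs as : StrongDual ℝ X}
    {r R : ℝ} (has : as ∈ T a) (ha : ‖a - x‖ < r) (ha' : ‖as - xs‖ < R) :
    as ∈ fattenedRange T x xs r R := by
  refine ⟨a, as, has, ha, ha', ?_⟩
  have : 0 < r := (norm_nonneg _).trans_lt ha
  rw [sub_self, norm_zero]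
  have := sub_pos.mpr ha
  have := sub_pos.mpr ha'
  positivity

theorem fattenedRange_subset_ball {T : X → Set (StrongDual ℝ X)} {x : X} {xs : StrongDual ℝ X}
    {r R : ℝ} : fattenedRange T x xs r R ⊆ Metric.ball xs R := by
  rintro ys ⟨a, as, -, ha, ha', hys⟩
  have hr : 0 < r := (norm_nonneg _).trans_lt ha
  have h1 : (r - ‖a - x‖) * (R - ‖as - xs‖) / (10 * r) ≤ R - ‖as - xs‖ := by
    rw [div_le_iff₀ (by positivity)]
    nlinarith [mul_nonneg (norm_nonneg (a - x)) (sub_nonneg.mpr ha'.le),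
      mul_nonneg hr.le (sub_nonneg.mpr ha'.le)]
  rw [mem_ball_iff_norm]
  have := norm_sub_le_norm_sub_add_norm_sub ys as xs
  linarith

theorem convexOn_penalty {μ N : ℝ} (hμ : 0 ≤ μ) (hN : 0 ≤ N) (x y : X) (s : ℝ)
    (ys : StrongDual ℝ X) :
    ConvexOn ℝ univ fun z => μ / 2 * ‖z - y‖ ^ 2 + N * max (‖z - x‖ - s) 0 - ys z := by
  have hn : ∀ w : X, ConvexOn ℝ univ fun z => ‖z - w‖ := fun w => by
    simpa [dist_eq_norm] using convexOn_univ_dist w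
  have h1 : ConvexOn ℝ univ fun z => ‖z - y‖ ^ 2 :=
    (hn y).pow (fun _ _ => norm_nonneg _) 2
  have h2 : ConvexOn ℝ univ fun z => max (‖z - x‖ - s) 0 := by
    have := ((hn x).add_const (-s)).sup (convexOn_const 0 convex_univ)
    refine this.congr fun z _ => ?_
    simp [sub_eq_add_neg]
  have h3 : ConcaveOn ℝ univ fun z => ys z := ys.toLinearMap.concaveOn convex_univ
  exact ((h1.smul (div_nonneg hμ zero_le_two)).add (h2.smul hN)).sub h3

theorem isSupercoercive_penalty {μ N : ℝ} (hμ : 0 < μ) (hN : 0 ≤ N) (x y : X) (s : ℝ)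
    (ys : StrongDual ℝ X) :
    IsSupercoercive fun z => μ / 2 * ‖z - y‖ ^ 2 + N * max (‖z - x‖ - s) 0 - ys z := by
  intro M
  set K := |M| + ‖ys‖ with hK
  refine ⟨K ^ 2 / (2 * μ) + K * ‖y‖, fun z => ?_⟩
  have h1 : ys z ≤ ‖ys‖ * ‖z‖ := (le_abs_self _).trans (ys.le_opNorm z)
  have h2 : M * ‖z‖ ≤ |M| * ‖z‖ := mul_le_mul_of_nonneg_right (le_abs_self M) (norm_nonneg z)
  have h3 : ‖z‖ ≤ ‖z - y‖ + ‖y‖ := by simpa using norm_add_le (z - y) y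
  have h4 : K * ‖z‖ ≤ K * (‖z - y‖ + ‖y‖) := mul_le_mul_of_nonneg_left h3 (by positivity)
  have h5 : 0 ≤ N * max (‖z - x‖ - s) 0 := mul_nonneg hN (le_max_right _ _)
  have h6 : K * ‖z - y‖ ≤ K ^ 2 / (2 * μ) + μ / 2 * ‖z - y‖ ^ 2 := by
    have : K ^ 2 / (2 * μ) + μ / 2 * ‖z - y‖ ^ 2 - K * ‖z - y‖
        = (K - μ * ‖z - y‖) ^ 2 / (2 * μ) := by field_simp; ring
    have : 0 ≤ (K - μ * ‖z - y‖) ^ 2 / (2 * μ) := by positivity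
    linarith
  have h7 : K * ‖z‖ = |M| * ‖z‖ + ‖ys‖ * ‖z‖ := by rw [hK]; ring
  dsimp only
  linarith

theorem hasFDerivAt_norm_sq_zero : HasFDerivAt (fun v : X => ‖v‖ ^ 2) (0 : StrongDual ℝ X) 0 := by
  rw [hasFDerivAt_iff_isLittleO_nhds_zero]
  simpa using Asymptotics.isLittleO_norm_pow_id (E' := X) one_lt_two

theorem eq_zero_of_eventually_le_mul_norm_sq {g : StrongDual ℝ X} {c : ℝ}
    (h : ∀ᶠ v in 𝓝 0, g v ≤ c * ‖v‖ ^ 2) : g = 0 := by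
  have hmin : IsLocalMin (fun v : X => c * ‖v‖ ^ 2 - g v) 0 := by
    filter_upwards [h] with v hv
    simpa using hv
  have := hmin.hasFDerivAt_eq_zero ((hasFDerivAt_norm_sq_zero.const_mul c).sub g.hasFDerivAt)
  simpa using this

/-- A maximal monotone operator `T` remains maximal among the monotone operators on the
neighborhood `ball x r ×ˢ fattenedRange T x xs r R` of a point `(x, xs)` of its graph.

For `(y, ys)` in that neighborhood, with `ys` near a value `as` at `a`, one solves
`ys ∈ T b + ∂(μ/2 ‖· - y‖² + N (‖· - x‖ - s)₊)(b)`. The penalty keeps `b` in the ball, and as `a`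
lies well inside the ball, the subgradient is small enough for the value of `T` at `b` to stay in
`ball xs R`, hence in the fattened range. Monotonicity then forces `b = y`. -/
theorem IsMaxMonotoneOp.mem_of_forall_nonneg_of_mem_ball (hX : IsReflexiveSpace X)
    {T : X → Set (StrongDual ℝ X)} (hT : IsMaxMonotoneOp T) {x : X} {xs : StrongDual ℝ X}
    {r R : ℝ} {y : X} {ys : StrongDual ℝ X} (hy : ‖y - x‖ < r)
    (hys : ys ∈ fattenedRange T x xs r R)
    (h : ∀ b, ∀ bs ∈ T b, ‖b - x‖ < r → bs ∈ fattenedRange T x xs r R →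
      0 ≤ (ys - bs) (y - b)) : ys ∈ T y := by
  obtain ⟨a, as, has, ha, ha', hya⟩ := hys
  have hr : 0 < r := (norm_nonneg _).trans_lt hy
  have hra : 0 < r - ‖a - x‖ := sub_pos.mpr ha
  have hRa : 0 < R - ‖as - xs‖ := sub_pos.mpr ha'
  -- With these constants the subgradient at `b` has norm at most `4 ε r / δ`, which together with `ε`
  -- stays below `R - ‖as - xs‖`; and outside the ball the penalty, of slope `N`, exceeds whatever
  -- the quadratic and the distance `ε` of `ys` from `as` can contribute.
  set ε := (r - ‖a - x‖) * (R - ‖as - xs‖) / (10 * r) with hε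
  have hεpos : 0 < ε := by positivity
  set μ := ε / r with hμ
  have hμpos : 0 < μ := by positivity
  have hμr : μ * r = ε := by rw [hμ]; field_simp
  set δ := (r - ‖a - x‖) / 2 with hδ
  have hδpos : 0 < δ := by positivity
  set s := max ((‖y - x‖ + r) / 2) (‖a - x‖ + δ) with hs
  have hsr : s < r := max_lt (by linarith) (by linarith)
  have hys : ‖y - x‖ < s := lt_max_of_lt_left (by linarith)
  have hrs : 0 < r - s := sub_pos.mpr hsr
  set N := 5 * ε * r / (r - s) with hN
  have hNpos : 0 < N := by positivity
  obtain ⟨b, bs, hbs, hsub⟩ := hT.exists_neg_mem_subgradient hX ⟨(a, as), has⟩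
    (convexOn_penalty hμpos.le hNpos.le x y s ys) (by fun_prop)
    (isSupercoercive_penalty hμpos hNpos.le x y s ys)
  -- The functional `ys - bs` is a subgradient at `b` of the function without its linear term.
  have hg : ∀ z, μ / 2 * ‖b - y‖ ^ 2 + N * max (‖b - x‖ - s) 0 + (ys - bs) (z - b)
      ≤ μ / 2 * ‖z - y‖ ^ 2 + N * max (‖z - x‖ - s) 0 := by
    intro z
    have := hsub z
    simp only [map_sub, sub_apply] at this ⊢
    linarith
  have hpen : ∀ z, ‖z - x‖ ≤ s → N * max (‖z - x‖ - s) 0 = 0 := fun z hz => by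
    rw [max_eq_right (sub_nonpos.mpr hz), mul_zero]
  have hquad : ∀ z, ‖z - x‖ ≤ s → μ / 2 * ‖z - y‖ ^ 2 ≤ 2 * ε * r := fun z hz => by
    have h1 : ‖z - y‖ ≤ 2 * r := by
      have := norm_sub_le_norm_sub_add_norm_sub z x y
      rw [norm_sub_rev x y] at this
      linarith
    have h2 : ‖z - y‖ ^ 2 ≤ (2 * r) ^ 2 := pow_le_pow_left₀ (norm_nonneg _) h1 2
    calc μ / 2 * ‖z - y‖ ^ 2 ≤ μ / 2 * (2 * r) ^ 2 := by gcongr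
      _ = 2 * (μ * r) * r := by ring
      _ = 2 * ε * r := by rw [hμr]
  have hab : (ys - bs) (b - a) ≤ ε * ‖b - a‖ := by
    have h1 := hT.1.nonneg hbs has
    have h2 := (le_abs_self _).trans ((ys - as).le_opNorm (b - a))
    have h3 : ‖ys - as‖ * ‖b - a‖ ≤ ε * ‖b - a‖ := by gcongr
    have h4 : (ys - bs) (b - a) = (ys - as) (b - a) - (bs - as) (b - a) := by
      simp only [sub_apply]; ring
    linarith
  have hsa : ‖a - x‖ + δ ≤ s := le_max_right _ _
  have hba : ‖b - a‖ ≤ ‖b - x‖ + r := by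
    have := norm_sub_le_norm_sub_add_norm_sub b x a
    rw [norm_sub_rev x a] at this
    linarith
  have hquad0 : 0 ≤ μ / 2 * ‖b - y‖ ^ 2 := by positivity
  have hpen0 : 0 ≤ N * max (‖b - x‖ - s) 0 := mul_nonneg hNpos.le (le_max_right _ _)
  have hbr : ‖b - x‖ < r := by
    by_contra! hrb
    have h1 := hg a
    rw [hpen a (by linarith), ← neg_sub b a, map_neg] at h1
    have h2 := hquad a (by linarith)
    have h3 : N * (‖b - x‖ - s) ≤ N * max (‖b - x‖ - s) 0 := by
      gcongr
      exact le_max_left _ _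
    have h4 : ε * ‖b - a‖ ≤ ε * (‖b - x‖ + r) := by gcongr
    have h5 : 5 * ε * ‖b - x‖ ≤ N * (‖b - x‖ - s) := by
      rw [hN, div_mul_eq_mul_div, le_div_iff₀ hrs]
      have hs0 : 0 ≤ s := (norm_nonneg _).trans hys.le
      have : ‖b - x‖ * (r - s) ≤ r * (‖b - x‖ - s) := by
        nlinarith [mul_nonneg hs0 (sub_nonneg.mpr hrb)]
      nlinarith
    have h6 : ε * r ≤ ε * ‖b - x‖ := by gcongr
    have h7 : 0 < ε * ‖b - x‖ := mul_pos hεpos (hr.trans_le hrb)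
    linarith
  have hgnorm : ‖ys - bs‖ ≤ 8 * (R - ‖as - xs‖) / 10 := by
    have h1 : ∀ v : X, ‖v‖ ≤ δ → (ys - bs) v ≤ 4 * ε * r := by
      intro v hv
      have hz : ‖a + v - x‖ ≤ s := by
        have : a + v - x = (a - x) + v := by abel
        rw [this]
        linarith [norm_add_le (a - x) v]
      have h2 := hg (a + v)
      rw [hpen _ hz] at h2
      have h3 := hquad _ hz
      have h4 : (ys - bs) (a + v - b) = (ys - bs) v - (ys - bs) (b - a) := by
        rw [← map_sub]; congr 1; abel
      have h5 : ε * ‖b - a‖ ≤ ε * (r + r) := by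
        gcongr
        linarith
      linarith
    have h2 : 4 * ε * r / δ = 8 * (R - ‖as - xs‖) / 10 := by
      rw [hε, hδ]; field_simp; norm_num
    rw [← h2]
    refine ContinuousLinearMap.opNorm_le_of_unit_norm (by positivity) fun v hv => ?_
    have hv' : ‖δ • v‖ ≤ δ := by rw [norm_smul, hv, Real.norm_of_nonneg hδpos.le, mul_one]
    rw [Real.norm_eq_abs, abs_le, le_div_iff₀ hδpos, neg_le, le_div_iff₀ hδpos]
    constructor
    · have := h1 (-(δ • v)) (by rwa [norm_neg])
      rw [map_neg, map_smul, smul_eq_mul] at this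
      linarith
    · have := h1 (δ • v) hv'
      rw [map_smul, smul_eq_mul] at this
      linarith
  have hbR : ‖bs - xs‖ < R := by
    have h1 : ‖bs - xs‖ ≤ ‖ys - bs‖ + ‖ys - as‖ + ‖as - xs‖ := by
      have : bs - xs = -(ys - bs) + (ys - as) + (as - xs) := by abel
      rw [this]
      refine (norm_add₃_le ..).trans ?_
      rw [norm_neg]
    have h2 : ε ≤ (R - ‖as - xs‖) / 10 := by
      rw [hε, div_le_div_iff₀ (by positivity) (by norm_num)]
      nlinarith [mul_nonneg (norm_nonneg (a - x)) hRa.le]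
    linarith
  have hq := h b bs hbs hbr (mem_fattenedRange hbs hbr hbR)
  have hyb : b = y := by
    have h1 := hg y
    rw [hpen y hys.le, sub_self, norm_zero] at h1
    have h2 : ‖b - y‖ ^ 2 ≤ 0 := by
      have : μ / 2 * ‖b - y‖ ^ 2 ≤ 0 := by linarith
      exact nonpos_of_mul_nonpos_right this (by positivity)
    have h3 : ‖b - y‖ = 0 := by
      have := sq_nonneg ‖b - y‖
      exact pow_eq_zero_iff two_ne_zero |>.mp (le_antisymm h2 this)
    exact sub_eq_zero.mp (norm_eq_zero.mp h3)
  subst hyb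
  have hz : ys - bs = 0 := by
    refine eq_zero_of_eventually_le_mul_norm_sq (c := μ / 2) ?_
    have hcont : Tendsto (fun v : X => ‖b + v - x‖) (𝓝 0) (𝓝 ‖b + 0 - x‖) :=
      Continuous.tendsto (by fun_prop) 0
    rw [add_zero] at hcont
    filter_upwards [hcont.eventually_lt_const hys] with v hv
    have := hg (b + v)
    rw [hpen _ hv.le, add_sub_cancel_left] at this
    linarith
  rwa [sub_eq_zero.mp hz]

theorem IsLocallyMaxMonotoneB.isLocallyMaxMonotoneA (hX : IsReflexiveSpace X)
    {T : X → Set (StrongDual ℝ X)} {x : X} {xs : StrongDual ℝ X} (hx : xs ∈ T x)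
    (h : IsLocallyMaxMonotoneB T x xs) : IsLocallyMaxMonotoneA T x xs := by
  obtain ⟨U, V, hU, hV, hxU, hxsV, S, hS, hST⟩ := h
  obtain ⟨r, hr, hrU⟩ := Metric.isOpen_iff.mp hU x hxU
  obtain ⟨R, hR, hRV⟩ := Metric.isOpen_iff.mp hV xs hxsV
  have hxS : xs ∈ S x := by
    have : (x, xs) ∈ mfGraph T ∩ U ×ˢ V := ⟨hx, hxU, hxsV⟩
    rw [← hST] at this
    exact this.1
  have hsub : Metric.ball x r ×ˢ fattenedRange S x xs r R ⊆ U ×ˢ V :=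
    prod_mono hrU (fattenedRange_subset_ball.trans hRV)
  have hST' : mfGraph S ∩ Metric.ball x r ×ˢ fattenedRange S x xs r R
      = mfGraph T ∩ Metric.ball x r ×ˢ fattenedRange S x xs r R := by
    rw [← inter_eq_right.mpr hsub, ← inter_assoc, hST, inter_assoc]
  refine ⟨Metric.ball x r, fattenedRange S x xs r R, Metric.isOpen_ball,
    isOpen_fattenedRange S x xs r R, Metric.mem_ball_self hr,
    mem_fattenedRange hxS (by simpa using hr) (by simpa using hR), ⟨S, hS.1, hST'⟩,
    fun S' hS' hTS' => hTS'.antisymm ?_⟩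
  rw [← hST'] at hTS' ⊢
  rintro ⟨y, ys⟩ hyS'
  refine ⟨hS.mem_of_forall_nonneg_of_mem_ball hX (mem_ball_iff_norm.mp hyS'.2.1) hyS'.2.2
    fun b bs hbs hb hb' => ?_, hyS'.2⟩
  exact isMonotoneOpWrt_iff.mp hS' _ hyS' (b, bs) (hTS' ⟨hbs, mem_ball_iff_norm.mpr hb, hb'⟩)

end Localization

/-! ### The duality mapping of a smooth, strictly convex, Kadec–Klee norm -/

section Duality

variable {X : Type*} [NormedAddCommGroup X] [NormedSpace ℝ X]

theorem norm_eq_of_mem_dualityMapping {x : X} {j : StrongDual ℝ X} (hj : j ∈ dualityMapping x) :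
    ‖j‖ = ‖x‖ := ((sq_eq_sq₀ (norm_nonneg _) (norm_nonneg _)).mp hj.2).symm

theorem apply_le_of_mem_dualityMapping {x : X} {j : StrongDual ℝ X} (hj : j ∈ dualityMapping x)
    (y : X) : j y ≤ ‖x‖ * ‖y‖ := by
  rw [← norm_eq_of_mem_dualityMapping hj]
  exact (le_abs_self _).trans (j.le_opNorm y)

theorem norm_sq_add_le_of_mem_dualityMapping {x : X} {j : StrongDual ℝ X}
    (hj : j ∈ dualityMapping x) (z : X) : ‖x‖ ^ 2 + 2 * j (z - x) ≤ ‖z‖ ^ 2 := by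
  have := apply_le_of_mem_dualityMapping hj z
  rw [map_sub, hj.1]
  nlinarith [sq_nonneg (‖x‖ - ‖z‖)]

theorem IsFrechetSmoothNorm.differentiableAt_norm_sq (hF : IsFrechetSmoothNorm X) (x : X) :
    DifferentiableAt ℝ (fun y : X => ‖y‖ ^ 2) x := by
  rcases eq_or_ne x 0 with rfl | hx
  · exact hasFDerivAt_norm_sq_zero.differentiableAt
  · exact (hF x hx).pow 2

variable (X) in
/-- Half the derivative of `‖·‖²`. For a Fréchet smooth norm this is the single-valued form of the
duality mapping, see `IsFrechetSmoothNorm.mem_dualityMapping_iff`. -/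
noncomputable def dualityFun (x : X) : StrongDual ℝ X :=
  (1 / 2 : ℝ) • fderiv ℝ (fun y : X => ‖y‖ ^ 2) x

theorem IsFrechetSmoothNorm.eq_dualityFun_of_subgradient (hF : IsFrechetSmoothNorm X) {x : X}
    {j : StrongDual ℝ X} (hj : ∀ z, ‖x‖ ^ 2 + 2 * j (z - x) ≤ ‖z‖ ^ 2) : j = dualityFun X x := by
  have hmin : IsLocalMin (fun z : X => ‖z‖ ^ 2 - (2 : ℝ) • j z) x := by
    refine Eventually.of_forall fun z => ?_
    have := hj z
    simp only [map_sub, smul_eq_mul] at this ⊢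
    linarith
  have := hmin.hasFDerivAt_eq_zero
    ((hF.differentiableAt_norm_sq x).hasFDerivAt.sub (j.hasFDerivAt.const_smul (2 : ℝ)))
  rw [dualityFun, sub_eq_zero.mp this, smul_smul]
  norm_num

theorem IsFrechetSmoothNorm.mem_dualityMapping_iff (hF : IsFrechetSmoothNorm X) {x : X}
    {j : StrongDual ℝ X} : j ∈ dualityMapping x ↔ j = dualityFun X x := by
  have h : ∀ k ∈ dualityMapping x, k = dualityFun X x := fun k hk =>
    hF.eq_dualityFun_of_subgradient (norm_sq_add_le_of_mem_dualityMapping hk)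
  refine ⟨h j, fun hj => ?_⟩
  obtain ⟨k, hk⟩ := dualityMapping_nonempty x
  rwa [hj, ← h k hk]

theorem IsFrechetSmoothNorm.dualityFun_mem (hF : IsFrechetSmoothNorm X) (x : X) :
    dualityFun X x ∈ dualityMapping x := hF.mem_dualityMapping_iff.mpr rfl

/-- The gradient of the Fréchet differentiable convex function `‖·‖²` is norm-to-norm continuous
(Šmulian). -/
theorem IsFrechetSmoothNorm.continuous_dualityFun (hF : IsFrechetSmoothNorm X) :
    Continuous (dualityFun X) := by
  rw [continuous_iff_continuousAt]
  intro x
  rw [ContinuousAt, Metric.tendsto_nhds]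
  intro ε hε
  set j := dualityFun X x with hj
  have hderiv : HasFDerivAt (fun y : X => ‖y‖ ^ 2) ((2 : ℝ) • j) x := by
    have := (hF.differentiableAt_norm_sq x).hasFDerivAt
    rwa [hj, dualityFun, smul_smul, show (2 : ℝ) * (1 / 2) = 1 by norm_num, one_smul]
  have hlo := (hasFDerivAt_iff_isLittleO_nhds_zero.mp hderiv).def (half_pos hε)
  obtain ⟨δ, hδ, hδ'⟩ := Metric.eventually_nhds_iff.mp hlo
  set η := δ / 2 with hη
  have hηpos : 0 < η := by positivity
  have hηb : ∀ v : X, ‖v‖ = η → ‖x + v‖ ^ 2 - ‖x‖ ^ 2 - 2 * j v ≤ ε / 2 * η := by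
    intro v hv
    have := hδ' (y := v) (by rw [dist_zero_right, hv]; linarith)
    rw [hv] at this
    exact (le_abs_self _).trans this
  -- The error made by replacing the base point `x` by `y` in the subgradient inequality.
  have herr : Tendsto (fun y : X => ‖x‖ ^ 2 - ‖y‖ ^ 2 + 2 * (‖y‖ * ‖y - x‖)) (𝓝 x)
      (𝓝 (‖x‖ ^ 2 - ‖x‖ ^ 2 + 2 * (‖x‖ * ‖x - x‖))) := Continuous.tendsto (by fun_prop) x
  simp only [sub_self, norm_zero, mul_zero, add_zero] at herr
  have hpos : 0 < ε / 2 * η := by positivity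
  filter_upwards [herr.eventually_lt_const hpos] with y hy
  rw [dist_eq_norm]
  have hJy := hF.dualityFun_mem y
  have hbound : ∀ v : X, ‖v‖ = η → (dualityFun X y - j) v ≤ ε / 2 * η := by
    intro v hv
    have h1 := norm_sq_add_le_of_mem_dualityMapping hJy (x + v)
    have h2 := hηb v hv
    have h3 : dualityFun X y (x + v - y) = dualityFun X y v - dualityFun X y (y - x) := by
      rw [← map_sub]; congr 1; abel
    have h4 : dualityFun X y (y - x) ≤ ‖y‖ * ‖y - x‖ :=
      apply_le_of_mem_dualityMapping hJy _
    rw [sub_apply]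
    linarith
  refine lt_of_le_of_lt (ContinuousLinearMap.opNorm_le_of_unit_norm (C := ε / 2) (by positivity)
    fun v hv => ?_) (half_lt_self hε)
  have hv' : ‖η • v‖ = η := by rw [norm_smul, hv, Real.norm_of_nonneg hηpos.le, mul_one]
  have h1 := hbound (η • v) hv'
  have h2 := hbound (-(η • v)) (by rwa [norm_neg])
  rw [map_neg, map_smul, smul_eq_mul] at h2
  rw [map_smul, smul_eq_mul] at h1
  rw [Real.norm_eq_abs, abs_le]
  constructor <;> nlinarith

theorem sq_norm_sub_norm_le_of_mem_dualityMapping {x y : X} {j k : StrongDual ℝ X}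
    (hj : j ∈ dualityMapping x) (hk : k ∈ dualityMapping y) :
    (‖x‖ - ‖y‖) ^ 2 + (‖x‖ * ‖y‖ - j y) ≤ (j - k) (x - y) := by
  have := apply_le_of_mem_dualityMapping hk x
  simp only [map_sub, sub_apply, hj.1, hk.1]
  linarith

/-- In a strictly convex space, a functional in `J x` attains the value `‖x‖²` on the ball of
radius `‖x‖` only at `x`. -/
theorem eq_of_mem_dualityMapping_of_apply_eq [StrictConvexSpace ℝ X] {x y : X}
    {j : StrongDual ℝ X} (hj : j ∈ dualityMapping x) (hy : ‖y‖ ≤ ‖x‖) (hjy : j y = ‖x‖ ^ 2) :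
    x = y := by
  rcases eq_or_ne x 0 with rfl | hx
  · rw [norm_zero] at hy
    exact (norm_le_zero_iff.mp hy).symm
  have hxpos : 0 < ‖x‖ := norm_pos_iff.mpr hx
  have h1 : ‖x‖ ≤ ‖y‖ := by
    have := apply_le_of_mem_dualityMapping hj y
    nlinarith
  have h2 : ‖x‖ + ‖y‖ ≤ ‖x + y‖ := by
    have := apply_le_of_mem_dualityMapping hj (x + y)
    rw [map_add, hj.1, hjy] at this
    nlinarith
  exact eq_of_norm_eq_of_norm_add_eq (h1.antisymm hy) ((norm_add_le x y).antisymm h2)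

theorem eq_of_dualityMapping_sub_nonpos [StrictConvexSpace ℝ X] {x y : X} {j k : StrongDual ℝ X}
    (hj : j ∈ dualityMapping x) (hk : k ∈ dualityMapping y) (h : (j - k) (x - y) ≤ 0) : x = y := by
  have h1 := sq_norm_sub_norm_le_of_mem_dualityMapping hj hk
  have h2 := apply_le_of_mem_dualityMapping hj y
  have h3 : ‖x‖ - ‖y‖ = 0 := by
    have := sq_nonneg (‖x‖ - ‖y‖)
    exact pow_eq_zero_iff two_ne_zero |>.mp (by linarith)
  have h4 : ‖y‖ = ‖x‖ := by linarith
  rw [h3, h4] at h1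
  rw [h4] at h2
  exact eq_of_mem_dualityMapping_of_apply_eq hj h4.le (by nlinarith)

/-- If `‖u n‖ → ‖x‖` and the values of `j ∈ J x` at `u n` tend to `‖x‖²`, then `u n → x`.

Every weak cluster point of `u` (these exist by Banach–Alaoglu and reflexivity) is `x` by strict
convexity, so `u` converges weakly to `x`, and the Kadec–Klee property applies. -/
theorem IsKadecKleeNorm.tendsto_of_apply_tendsto [StrictConvexSpace ℝ X]
    (hK : IsKadecKleeNorm X) (hX : IsReflexiveSpace X) {x : X} {j : StrongDual ℝ X}
    (hj : j ∈ dualityMapping x) {u : ℕ → X} (hu : Tendsto (fun n => ‖u n‖) atTop (𝓝 ‖x‖))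
    (hju : Tendsto (fun n => j (u n)) atTop (𝓝 (‖x‖ ^ 2))) : Tendsto u atTop (𝓝 x) := by
  refine hK u x (fun f => ?_) hu
  rw [tendsto_iff_ultrafilter]
  intro 𝒰 h𝒰
  obtain ⟨M, hM⟩ := hu.bddAbove_range
  have hcomp := WeakDual.isCompact_closedBall (0 : StrongDual ℝ (StrongDual ℝ X)) M
  set w : ℕ → WeakDual ℝ (StrongDual ℝ X) :=
    fun n => StrongDual.toWeakDual (NormedSpace.inclusionInDoubleDual ℝ X (u n)) with hw
  have hmem : ∀ n, w n ∈ WeakDual.toStrongDual ⁻¹' Metric.closedBall (0 : StrongDual ℝ _) M := by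
    intro n
    exact (mem_closedBall_zero_iff (E := StrongDual ℝ (StrongDual ℝ X))).mpr
      ((NormedSpace.double_dual_bound ℝ X (u n)).trans (hM ⟨n, rfl⟩))
  obtain ⟨Ψ, -, hΨ⟩ := hcomp.ultrafilter_le_nhds (𝒰.map w)
    (le_principal_iff.mpr (mem_map.mpr (Eventually.of_forall hmem)))
  obtain ⟨y, hy⟩ := hX (WeakDual.toStrongDual Ψ)
  have hlim : ∀ g : StrongDual ℝ X, Tendsto (fun n => g (u n)) 𝒰 (𝓝 (g y)) := by
    intro g
    have h1 := ((WeakDual.eval_continuous g).tendsto Ψ).comp (show Tendsto w 𝒰 (𝓝 Ψ) from hΨ)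
    have h2 : Ψ g = g y := by
      rw [← NormedSpace.dual_def ℝ X y g, hy]
      rfl
    rw [← h2]
    exact h1
  have hjy : j y = ‖x‖ ^ 2 := tendsto_nhds_unique (hlim j) (hju.mono_left h𝒰)
  have hyx : ‖y‖ ≤ ‖x‖ := by
    obtain ⟨g, hg, hgy⟩ := exists_dual_vector'' ℝ y
    have h1 : g y = ‖y‖ := by simpa using hgy
    rw [← h1]
    refine le_of_tendsto_of_tendsto' (hlim g) (hu.mono_left h𝒰) fun n => ?_
    have h2 := (le_abs_self _).trans (g.le_opNorm (u n))
    nlinarith [norm_nonneg (u n)]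
  rw [eq_of_mem_dualityMapping_of_apply_eq hj hyx hjy]
  exact hlim f

end Duality

/-! ### Resolvents and their localizations -/

section Resolvent

variable {X : Type*} [NormedAddCommGroup X] [NormedSpace ℝ X]

theorem IsFrechetSmoothNorm.mem_dualityResolvent_iff (hF : IsFrechetSmoothNorm X)
    {T : X → Set (StrongDual ℝ X)} {lam : ℝ} {zs : StrongDual ℝ X} {x : X} :
    x ∈ dualityResolvent T lam zs ↔ ∃ xs ∈ T x, zs = dualityFun X x + lam • xs := by
  constructor
  · rintro ⟨j, hj, xs, hxs, rfl⟩
    exact ⟨xs, hxs, by rw [hF.mem_dualityMapping_iff.mp hj]⟩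
  · rintro ⟨xs, hxs, rfl⟩
    exact ⟨_, hF.dualityFun_mem x, xs, hxs, rfl⟩

/-- Minty–Rockafellar: `J + lam T` is onto for maximal monotone `T`. -/
theorem IsMaxMonotoneOp.exists_dualityFun_add_smul_eq (hX : IsReflexiveSpace X)
    (hF : IsFrechetSmoothNorm X) {T : X → Set (StrongDual ℝ X)} (hT : IsMaxMonotoneOp T)
    (hne : (mfGraph T).Nonempty) {lam : ℝ} (hlam : 0 < lam) (zs : StrongDual ℝ X) :
    ∃ x, ∃ xs ∈ T x, dualityFun X x + lam • xs = zs := by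
  obtain ⟨b, bs, hbs, hsub⟩ := hT.exists_neg_mem_subgradient hX hne
    (convexOn_penalty (inv_nonneg.mpr hlam.le) le_rfl 0 0 0 (lam⁻¹ • zs)) (by fun_prop)
    (isSupercoercive_penalty (inv_pos.mpr hlam) le_rfl 0 0 0 (lam⁻¹ • zs))
  refine ⟨b, bs, hbs, ?_⟩
  have h : zs - lam • bs = dualityFun X b := hF.eq_dualityFun_of_subgradient fun z => by
    have h1 := mul_le_mul_of_nonneg_left (hsub z) (mul_nonneg zero_le_two hlam.le)
    simp only [sub_zero, zero_mul, add_zero, map_sub, sub_apply, smul_apply, smul_eq_mul] at h1 ⊢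
    have h2 : ∀ t, lam * (lam⁻¹ * t) = t := fun t => by field_simp
    have h3 := h2 (‖b‖ ^ 2)
    have h4 := h2 (‖z‖ ^ 2)
    have h5 := h2 (zs b)
    have h6 := h2 (zs z)
    linarith
  rw [← h]
  abel

/-- The resolvent of a monotone operator is sequentially continuous along its graph: if
`J uₙ + lam uₙ* → J x + lam x*` with `uₙ* ∈ T uₙ` and `x* ∈ T x`, then `uₙ → x`. -/
theorem IsMonotoneOp.tendsto_of_dualityFun_add_smul_tendsto [StrictConvexSpace ℝ X]
    (hX : IsReflexiveSpace X) (hF : IsFrechetSmoothNorm X) (hK : IsKadecKleeNorm X)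
    {T : X → Set (StrongDual ℝ X)} (hT : IsMonotoneOp T) {lam : ℝ} (hlam : 0 < lam)
    {u : ℕ → X} {us : ℕ → StrongDual ℝ X} (hu : ∀ n, us n ∈ T (u n)) {x : X}
    {xs : StrongDual ℝ X} (hx : xs ∈ T x)
    (h : Tendsto (fun n => dualityFun X (u n) + lam • us n) atTop
      (𝓝 (dualityFun X x + lam • xs))) :
    Tendsto u atTop (𝓝 x) := by
  set d : ℕ → ℝ := fun n => ‖(dualityFun X (u n) + lam • us n) - (dualityFun X x + lam • xs)‖
    with hd
  have hd0 : Tendsto d atTop (𝓝 0) := tendsto_iff_norm_sub_tendsto_zero.mp h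
  have hdnn : ∀ n, 0 ≤ d n := fun n => norm_nonneg _
  have hkey : ∀ n, (‖x‖ - ‖u n‖) ^ 2 + (‖x‖ * ‖u n‖ - dualityFun X x (u n))
      ≤ d n * (‖u n‖ + ‖x‖) := by
    intro n
    have h1 := sq_norm_sub_norm_le_of_mem_dualityMapping (hF.dualityFun_mem x)
      (hF.dualityFun_mem (u n))
    have h2 := mul_nonneg hlam.le (hT.nonneg (hu n) hx)
    have h3 := (le_abs_self _).trans
      (((dualityFun X (u n) + lam • us n) - (dualityFun X x + lam • xs)).le_opNorm (u n - x))
    have h4 : d n * ‖u n - x‖ ≤ d n * (‖u n‖ + ‖x‖) :=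
      mul_le_mul_of_nonneg_left (norm_sub_le _ _) (hdnn n)
    have h5 : ((dualityFun X (u n) + lam • us n) - (dualityFun X x + lam • xs)) (u n - x)
        = (dualityFun X x - dualityFun X (u n)) (x - u n) + lam * (us n - xs) (u n - x) := by
      simp only [map_sub, sub_apply, add_apply, smul_apply, smul_eq_mul]
      ring
    linarith
  have hgap : ∀ n, 0 ≤ ‖x‖ * ‖u n‖ - dualityFun X x (u n) := fun n =>
    sub_nonneg.mpr (apply_le_of_mem_dualityMapping (hF.dualityFun_mem x) (u n))
  have hbound : ∀ᶠ n in atTop, ‖u n‖ ≤ 2 * ‖x‖ + 2 := by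
    filter_upwards [hd0.eventually_lt_const (show (0 : ℝ) < 1 / 4 by norm_num)] with n hn
    have h1 := hkey n
    have h2 := hgap n
    by_contra! hlt
    have := norm_nonneg x
    nlinarith [hdnn n]
  have hzero : Tendsto (fun n => d n * (3 * ‖x‖ + 2)) atTop (𝓝 0) := by
    simpa using hd0.mul_const (3 * ‖x‖ + 2)
  have hle : ∀ᶠ n in atTop, d n * (‖u n‖ + ‖x‖) ≤ d n * (3 * ‖x‖ + 2) := by
    filter_upwards [hbound] with n hn
    exact mul_le_mul_of_nonneg_left (by linarith) (hdnn n)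
  have hnorm : Tendsto (fun n => ‖u n‖) atTop (𝓝 ‖x‖) := by
    have h1 : Tendsto (fun n => (‖x‖ - ‖u n‖) ^ 2) atTop (𝓝 0) := by
      refine squeeze_zero' (Eventually.of_forall fun n => sq_nonneg _) ?_ hzero
      filter_upwards [hle] with n hn
      linarith [hkey n, hgap n]
    have h2 : Tendsto (fun n => ‖x‖ - ‖u n‖) atTop (𝓝 0) := by
      rw [tendsto_zero_iff_abs_tendsto_zero]
      have := (Real.continuous_sqrt.tendsto 0).comp h1
      simpa [Function.comp_def, Real.sqrt_sq_eq_abs] using this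
    simpa using (tendsto_const_nhds (x := ‖x‖)).sub h2
  have hgap0 : Tendsto (fun n => ‖x‖ * ‖u n‖ - dualityFun X x (u n)) atTop (𝓝 0) := by
    refine squeeze_zero' (Eventually.of_forall hgap) ?_ hzero
    filter_upwards [hle] with n hn
    linarith [hkey n, sq_nonneg (‖x‖ - ‖u n‖)]
  refine hK.tendsto_of_apply_tendsto hX (hF.dualityFun_mem x) hnorm ?_
  have := (hnorm.const_mul ‖x‖).sub hgap0
  simpa [sq] using this

/-- On the graph of a monotone operator, `(x, x*) ↦ J x + lam x*` is injective. -/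
theorem IsMonotoneOp.eq_of_dualityFun_add_smul_eq [StrictConvexSpace ℝ X]
    (hF : IsFrechetSmoothNorm X) {T : X → Set (StrongDual ℝ X)} (hT : IsMonotoneOp T) {lam : ℝ}
    (hlam : 0 < lam) {x y : X} {xs ys : StrongDual ℝ X} (hx : xs ∈ T x) (hy : ys ∈ T y)
    (h : dualityFun X x + lam • xs = dualityFun X y + lam • ys) : x = y ∧ xs = ys := by
  have hxy : x = y := by
    refine eq_of_dualityMapping_sub_nonpos (hF.dualityFun_mem x) (hF.dualityFun_mem y) ?_
    have h1 : dualityFun X x - dualityFun X y = -(lam • (xs - ys)) := by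
      rw [smul_sub, sub_eq_iff_eq_add, ← sub_eq_zero]
      rw [← sub_eq_zero] at h
      rw [← h]
      abel
    rw [h1, neg_apply, smul_apply, smul_eq_mul]
    linarith [mul_nonneg hlam.le (hT.nonneg hx hy)]
  subst hxy
  exact ⟨rfl, smul_right_injective _ hlam.ne' (add_left_cancel h)⟩

theorem IsLocallyMaxMonotoneB.isLocallyMonotone {T : X → Set (StrongDual ℝ X)} {x : X}
    {xs : StrongDual ℝ X} (h : IsLocallyMaxMonotoneB T x xs) : IsLocallyMonotone T x xs := by
  obtain ⟨U, V, hU, hV, hx, hxs, S, hS, hST⟩ := h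
  exact ⟨U, V, hU, hV, hx, hxs, S, hS.1, hST⟩

/-- The resolvent of a globally maximal monotone operator is a continuous function on all of `X*`;
near `(J x + lam x*, x)` it agrees with the resolvent of `T`, because there the values of the two
operators involved are forced to lie near `x*`. -/
theorem IsLocallyMaxMonotoneB.hasContSingleValuedLocalization [StrictConvexSpace ℝ X]
    (hX : IsReflexiveSpace X) (hF : IsFrechetSmoothNorm X) (hK : IsKadecKleeNorm X)
    {T : X → Set (StrongDual ℝ X)} {x : X} {xs : StrongDual ℝ X} (hx : xs ∈ T x)
    (h : IsLocallyMaxMonotoneB T x xs) {lam : ℝ} (hlam : 0 < lam) :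
    HasContSingleValuedLocalization (dualityResolvent T lam) (dualityFun X x + lam • xs) x := by
  obtain ⟨S, hS, hST⟩ := isLocallyMaxMonotoneB_iff_eventually.mp h
  have hxS : xs ∈ S x := hST.self_of_nhds.mpr hx
  choose g gs hgs hg using hS.exists_dualityFun_add_smul_eq hX hF ⟨(x, xs), hxS⟩ hlam
  have hgcont : Continuous g := by
    rw [continuous_iff_seqContinuous]
    intro z z₀ hz
    refine hS.1.tendsto_of_dualityFun_add_smul_tendsto hX hF hK hlam (us := fun n => gs (z n))
      (fun n => hgs (z n)) (hgs z₀) ?_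
    simpa only [Function.comp_apply, hg] using hz
  have hgx : g (dualityFun X x + lam • xs) = x :=
    (hS.1.eq_of_dualityFun_add_smul_eq hF hlam (hgs _) hxS (hg _)).1
  -- A point `v` together with `z = J v + lam v*` determines `v*`, continuously.
  set G : StrongDual ℝ X × X → X × StrongDual ℝ X :=
    fun w => (w.2, lam⁻¹ • (w.1 - dualityFun X w.2)) with hG
  have hGeq : ∀ z v vs, z = dualityFun X v + lam • vs → G (z, v) = (v, vs) := by
    rintro _ v vs rfl
    simp [hG, smul_smul, hlam.ne']
  have hGcont : Continuous G := by
    have := hF.continuous_dualityFun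
    fun_prop
  have hnear : ∀ᶠ w in 𝓝 (dualityFun X x + lam • xs, x),
      (G w ∈ mfGraph S ↔ G w ∈ mfGraph T) := by
    have := hGcont.tendsto (dualityFun X x + lam • xs, x)
    rw [hGeq _ _ _ rfl] at this
    exact this.eventually hST
  obtain ⟨U, V, hU, hzU, hV, hxV, hUV⟩ := mem_nhds_prod_iff'.mp hnear
  refine ⟨U ∩ g ⁻¹' V, V, hU.inter (hV.preimage hgcont), hV, ⟨hzU, by rwa [mem_preimage, hgx]⟩,
    hxV, fun z => {v | v ∈ dualityResolvent T lam z ∧ z ∈ U ∩ g ⁻¹' V ∧ v ∈ V}, ?_, g,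
    hgcont.continuousOn, fun z hz => ?_⟩
  · ext ⟨z, v⟩
    rfl
  · ext v
    simp only [mem_ofPred_eq, mem_singleton_iff, hF.mem_dualityResolvent_iff]
    constructor
    · rintro ⟨⟨vs, hvs, hzv⟩, -, hvV⟩
      have hvS : vs ∈ S v := by
        have : G (z, v) ∈ mfGraph S ↔ G (z, v) ∈ mfGraph T := hUV (mk_mem_prod hz.1 hvV)
        rw [hGeq z v vs hzv] at this
        exact this.mpr hvs
      exact (hS.1.eq_of_dualityFun_add_smul_eq hF hlam hvS (hgs z) (by rw [hg, hzv])).1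
    · rintro rfl
      refine ⟨⟨gs z, ?_, (hg z).symm⟩, hz, hz.2⟩
      have : G (z, g z) ∈ mfGraph S ↔ G (z, g z) ∈ mfGraph T := hUV (mk_mem_prod hz.1 hz.2)
      rw [hGeq z _ _ (hg z).symm] at this
      exact this.mp (hgs z)

/-- Extend `T`, cut down to a neighborhood, to a maximal monotone `S`. Each point of the graph of
`S` near `(x, xs)` has the same image under `(v, v*) ↦ J v + v*` as some point of the graph of `T`,
supplied by the localized resolvent, and this map is injective on the graph of `S`. -/
theorem IsLocallyMonotone.isLocallyMaxMonotoneB [StrictConvexSpace ℝ X]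
    (hF : IsFrechetSmoothNorm X) {T : X → Set (StrongDual ℝ X)} {x : X} {xs : StrongDual ℝ X}
    (hx : xs ∈ T x) (h : IsLocallyMonotone T x xs)
    (hres : HasContSingleValuedLocalization (dualityResolvent T 1) (dualityFun X x + xs) x) :
    IsLocallyMaxMonotoneB T x xs := by
  obtain ⟨U, V, hU, hV, hxU, hxsV, hT⟩ := h
  obtain ⟨S, hS, hTS⟩ := hT.exists_isMaxMonotoneOp
  refine isLocallyMaxMonotoneB_iff_eventually.mpr ⟨S, hS, ?_⟩
  have hW : ∀ᶠ p in 𝓝 (x, xs), p ∈ U ×ˢ V := (hU.prod hV).mem_nhds ⟨hxU, hxsV⟩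
  obtain ⟨U', V', hU', hV', hzU', hxV', G, hG, g, hgcont, hg⟩ := hres
  have hgraph : ∀ z ∈ U', ∀ v, (v ∈ dualityResolvent T 1 z ∧ v ∈ V') ↔ v = g z := by
    intro z hz v
    have h1 := Set.ext_iff.mp hG (z, v)
    have h2 : v ∈ G z ↔ v = g z := by rw [hg z hz]; rfl
    rw [← h2]
    exact ⟨fun hv => h1.mpr ⟨hv.1, hz, hv.2⟩, fun hv => ⟨(h1.mp hv).1, (h1.mp hv).2.2⟩⟩
  have hgx : g (dualityFun X x + xs) = x := by
    refine ((hgraph _ hzU' x).mp ⟨?_, hxV'⟩).symm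
    exact hF.mem_dualityResolvent_iff.mpr ⟨xs, hx, by rw [one_smul]⟩
  have hJ := hF.continuous_dualityFun
  have hsum : Continuous fun p : X × StrongDual ℝ X => dualityFun X p.1 + p.2 := by fun_prop
  have hzU : ∀ᶠ p in 𝓝 (x, xs), dualityFun X p.1 + p.2 ∈ U' :=
    hsum.continuousAt.eventually (hU'.mem_nhds hzU')
  have hgat : ContinuousAt (fun p : X × StrongDual ℝ X => g (dualityFun X p.1 + p.2)) (x, xs) :=
    ContinuousAt.comp (f := fun p : X × StrongDual ℝ X => dualityFun X p.1 + p.2)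
      (hgcont.continuousAt (hU'.mem_nhds hzU')) hsum.continuousAt
  have hpair : ContinuousAt (fun p : X × StrongDual ℝ X => (g (dualityFun X p.1 + p.2),
      dualityFun X p.1 + p.2 - dualityFun X (g (dualityFun X p.1 + p.2)))) (x, xs) :=
    hgat.prodMk (hsum.continuousAt.sub (hJ.continuousAt.comp hgat))
  have hgW : ∀ᶠ p in 𝓝 (x, xs), (g (dualityFun X p.1 + p.2),
      dualityFun X p.1 + p.2 - dualityFun X (g (dualityFun X p.1 + p.2))) ∈ U ×ˢ V := by
    refine hpair.eventually ?_
    dsimp only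
    rw [hgx, add_sub_cancel_left]
    exact hW
  filter_upwards [hW, hzU, hgW] with p hp hpU hpW
  refine ⟨fun hpS => ?_, fun hpT => hTS ⟨hpT, hp⟩⟩
  obtain ⟨vs, hvs, hz⟩ := hF.mem_dualityResolvent_iff.mp ((hgraph _ hpU _).mpr rfl).1
  rw [one_smul] at hz
  rw [sub_eq_of_eq_add' hz] at hpW
  have hvS : vs ∈ S (g (dualityFun X p.1 + p.2)) := hTS ⟨hvs, hpW⟩
  obtain ⟨h1, h2⟩ := hS.1.eq_of_dualityFun_add_smul_eq hF one_pos hpS hvS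
    (by rw [one_smul, one_smul]; exact hz)
  rw [show p = (g (dualityFun X p.1 + p.2), vs) from Prod.ext h1 h2]
  exact hvs

end Resolvent

/-! ### The local Minty theorem -/

theorem mainTheorem1 {X : Type*} [NormedAddCommGroup X] [NormedSpace ℝ X] [CompleteSpace X]
    (hX : IsReflexiveSpace X)
    (T : X → Set (StrongDual ℝ X)) (x : X) (xs : StrongDual ℝ X) (hT : (x, xs) ∈ mfGraph T) :
    (IsFrechetSmoothNorm X → StrictConvexSpace ℝ X → IsKadecKleeNorm X →
      List.TFAE [
        IsLocallyMaxMonotoneB T x xs,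
        IsLocallyMonotone T x xs ∧
          ∀ lam : ℝ, 0 < lam → ∀ j ∈ dualityMapping x,
            HasContSingleValuedLocalization (dualityResolvent T lam) (j + lam • xs) x,
        IsLocallyMaxMonotoneA T x xs]) ∧
    (IsLocallyMaxMonotoneA T x xs ↔ IsLocallyMaxMonotoneB T x xs) := by
  have hAB : IsLocallyMaxMonotoneA T x xs ↔ IsLocallyMaxMonotoneB T x xs :=
    ⟨fun h => h.isLocallyMaxMonotoneB, fun h => h.isLocallyMaxMonotoneA hX hT⟩
  refine ⟨fun hF _ hK => ?_, hAB⟩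
  tfae_have 1 ↔ 3 := hAB.symm
  tfae_have 1 → 2 := fun h => ⟨h.isLocallyMonotone, fun lam hlam j hj => by
    rw [hF.mem_dualityMapping_iff.mp hj]
    exact h.hasContSingleValuedLocalization hX hF hK hT hlam⟩
  tfae_have 2 → 1 := fun h => h.1.isLocallyMaxMonotoneB hF hT (by
    simpa only [one_smul] using h.2 1 one_pos _ (hF.dualityFun_mem x))
  tfae_finish
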